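/- Let $\mathbb F$ be a finite field and let $n,k,\delta$ be positive integers with $k<n$ and $(n-k)\nmid\delta$. Put $\nu=\lfloor\delta/(n-k)\rfloor+1$ and $L=\lfloor\delta/k\rfloor+\nu-1$, so that $L=\lfloor\delta/k\rfloor+\lfloor\delta/(n-k)\rfloor$. Let $H(z)=\sum_{i=0}^{\nu}H_iz^i$ with $H_i\in\mathbb F^{(n-k)\times n}$ be a row-reduced polynomial matrix (that is, the sum of its row degrees is minimal among all matrices $U(z)H(z)$ with $U(z)\in\mathrm{GL}_{n-k}(\mathbb F[z])$) whose row degrees sum to $\delta$. Put $H_i=0$ for $i>\nu$ and $i<0$. Suppose that: 1. all full-size minors that are not trivially zero of the truncated sliding matrix $H_L^c=(H_{i-l})_{0\le i,l\le L}\in\mathbb F^{(L+1)(n-k)\times(L+1)n}$ are nonzero, i.e. every minor on columns $1\le t_1<\dots<t_{(L+1)(n-k)}\le (L+1)n$ with $t_{s(n-k)}\le sn$ for $s=1,\dots,L$ is nonzero; 2. there are $r\in\mathbb N_0$ and a set $S\subseteq\{1,\dots,n-k\}$ with $|S|=\delta-(n-k)\lfloor\delta/(n-k)\rfloor$ such that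 the matrix $$\bar H=\begin{bmatrix}H_0\\ \vdots&\ddots\\ H_\nu&&H_0\\ &\ddots&\vdots\\ &&\tilde H_\nu\end{bmatrix}$$ has full row rank. Here $\bar H$ has $r+1$ block columns and $r+\nu+1$ block rows; the first $r+\nu$ block rows are $(H_{i-l})_{0\le l\le r}$, $0\le i<r+\nu$, and the last one is $(0\ \cdots\ 0\ \tilde H_\nu)$, where $\tilde H_\nu$ consists of the rows of $H_\nu$ with index in $S$. Then $H(z)$ is left prime (in every factorization $H(z)=M(z)B(z)$ with $M(z)\in\mathbb F[z]^{(n-k)\times(n-k)}$ and $B(z)\in\mathbb F[z]^{(n-k)\times n}$, the factor $M(z)$ is unimodular), and $H(z)$ is a parity-check matrix of an $(n,k,\delta)$ MDP convolutional code $\mathcal C$. This means: $\mathcal C=\{c\in\mathbb F[z]^n: H(z)c(z)^\top=0\}$ is a submodule of $\mathbb F[z]^n$ of rank $k$; the highest degree of the $k\times k$ minors of a matrix whose rows form a basis of $\mathcal C$ is $\delta$; and for all $j=0,\dots,L$ the column distance $d_j^c=\min\{\sum_{i=0}^{j}\mathrm{wt}(v_i): v=\sum_i v_iz^i\in\mathcal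 C,\ v_0\neq0\}$, where $\mathrm{wt}$ is the Hamming weight, equals $(n-k)(j+1)+1$. -/

import Mathlib

open scoped Polynomial

namespace ConvCode

noncomputable section

variable {F : Type*} [Field F] {m n k : ℕ}

/-- A polynomial matrix is left prime if the left (square) factor in each of its factorizations
is unimodular, i.e. invertible over `F[X]`. -/
def IsLeftPrime (A : Matrix (Fin m) (Fin n) F[X]) : Prop :=
  ∀ (M : Matrix (Fin m) (Fin m) F[X]) (B : Matrix (Fin m) (Fin n) F[X]), A = M * B → IsUnit M

/-- The largest degree among the entries of row `a`. -/
def rowDegree (A : Matrix (Fin m) (Fin n) F[X]) (a : Fin m) : ℕ :=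
  Finset.univ.sup fun b => (A a b).natDegree

/-- Row-reduced (minimal): the sum of the row degrees is the smallest possible among all matrices
`U * A` with `U` unimodular. -/
def IsRowReduced (A : Matrix (Fin m) (Fin n) F[X]) : Prop :=
  ∀ U : Matrix (Fin m) (Fin m) F[X], IsUnit U →
    ∑ a, rowDegree A a ≤ ∑ a, rowDegree (U * A) a

/-- The rows of `G` form a basis of the code. -/
def IsGeneratorMatrix (G : Matrix (Fin k) (Fin n) F[X]) (C : Submodule F[X] (Fin n → F[X])) :
    Prop :=
  LinearIndependent F[X] G.row ∧ Submodule.span F[X] (Set.range G.row) = C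

/-- The highest degree of the `k × k` minors of a `k × n` polynomial matrix. -/
def maxMinorDegree (G : Matrix (Fin k) (Fin n) F[X]) : ℕ :=
  Finset.univ.sup fun t : Fin k ↪o Fin n => (G.submatrix id t).det.natDegree

/-- `(n, k, δ)` convolutional codes: submodules of `F[X]^n` of rank `k` and degree `δ`, the degree
being the highest degree of the full-size minors of a generator matrix. (Two generator matrices
differ by a unimodular factor, so the choice of `G` does not matter.) -/
def IsConvolutionalCode (n k δ : ℕ) (C : Submodule F[X] (Fin n → F[X])) : Prop :=
  Module.finrank F[X] C = k ∧
    ∃ G : Matrix (Fin k) (Fin n) F[X], IsGeneratorMatrix G C ∧ maxMinorDegree G = δ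

def IsParityCheckMatrix (H : Matrix (Fin m) (Fin n) F[X]) (C : Submodule F[X] (Fin n → F[X])) :
    Prop :=
  ∀ c : Fin n → F[X], c ∈ C ↔ H.mulVec c = 0

open Classical in
/-- The Hamming weight of the truncation `v_0 + v_1 z + ⋯ + v_j z^j` of `v`. -/
def truncWeight (v : Fin n → F[X]) (j : ℕ) : ℕ :=
  ∑ i ∈ Finset.range (j + 1), hammingNorm fun b => (v b).coeff i

/-- The `j`-th column distance: the least weight of `v_0 + ⋯ + v_j z^j` over the codewords `v`
with `v_0 ≠ 0`. (It is `0` if there is no such codeword.) -/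
def columnDistance (C : Submodule F[X] (Fin n → F[X])) (j : ℕ) : ℕ :=
  sInf {w | ∃ v ∈ C, (fun b => (v b).coeff 0) ≠ 0 ∧ truncWeight v j = w}

/-- `(n, k, δ)` convolutional codes with maximum distance profile. -/
def IsMDP (n k δ : ℕ) (C : Submodule F[X] (Fin n → F[X])) : Prop :=
  IsConvolutionalCode n k δ C ∧
    ∀ j ≤ δ / k + δ / (n - k), columnDistance C j = (n - k) * (j + 1) + 1

/-- The truncated sliding parity-check matrix `H_j^c`: its block in block row `i` and block column
`l` is the coefficient `H_{i-l}` if `l ≤ i`, and `0` otherwise. Row `p` is row `p % m` of block row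
`p / m`, and column `q` is column `q % n` of block column `q / n`. -/
def slidingMatrix (H : Matrix (Fin m) (Fin n) F[X]) (j : ℕ) :
    Matrix (Fin ((j + 1) * m)) (Fin ((j + 1) * n)) F :=
  Matrix.of fun p q =>
    if q.divNat ≤ p.divNat then
      (H p.modNat q.modNat).coeff ((p.divNat : ℕ) - (q.divNat : ℕ))
    else 0

/-- All full-size minors of `H_j^c` that are not trivially zero are nonzero. In one-based
numbering, the minor on the columns `t_1 < ⋯ < t_{(j+1)m}` is not trivially zero if
`t_{sm} ≤ sn` for `s = 1, …, j`, i.e. if for each `s` at least `sm` of its columns meet the first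
`s` block rows, which are supported on the first `sn` columns. Below, rows and columns are numbered
from zero, so `t_{sm} ≤ sn` reads `t i < s * n` at the index `i` with `i + 1 = s * m`. -/
def MDPMinorCriterion (H : Matrix (Fin m) (Fin n) F[X]) (j : ℕ) : Prop :=
  ∀ t : Fin ((j + 1) * m) ↪o Fin ((j + 1) * n),
    (∀ (s : ℕ) (i : Fin ((j + 1) * m)), 1 ≤ s → s ≤ j → (i : ℕ) + 1 = s * m →
      (t i : ℕ) < s * n) →
    ((slidingMatrix H j).submatrix id t).det ≠ 0

/-- The matrix `H̄` for a matrix `H = H_0 + ⋯ + H_ν z^ν`: it has `r + 1` block columns and `r + ν`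
complete block rows, the block in position `(i, l)` being `H_{i-l}` if `l ≤ i` and `0` otherwise,
followed by the last block row `(0 ⋯ 0 H̃_ν)`, in which `H̃_ν` consists of the rows of `H_ν`
with index in `S`. -/
def barMatrix (H : Matrix (Fin m) (Fin n) F[X]) (ν r : ℕ) (S : Finset (Fin m)) :
    Matrix ((Fin (r + ν) × Fin m) ⊕ S) (Fin (r + 1) × Fin n) F :=
  Matrix.of fun p q =>
    match p with
    | Sum.inl (i, a) =>
        if (q.1 : ℕ) ≤ (i : ℕ) then (H a q.2).coeff ((i : ℕ) - (q.1 : ℕ)) else 0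
    | Sum.inr a => if (q.1 : ℕ) = r then (H a q.2).coeff ν else 0

end

end ConvCode

open scoped Polynomial

namespace ConvCode

/-! ### Linear algebra: minors and their degrees. -/

section LinearAlgebra

/-! Put m = n - k. Since H̄ has full row rank, H̄ x = y is solvable for every y. Solving it for the
coefficients of the columns of the identity matrix gives a polynomial matrix X with H X = 1
(`exists_mul_eq_one_of_linearIndependent_barMatrix`). Hence H is left prime, and its kernel, which
is the code, has rank k.

Independent rows are nonzero, so the rows of H have degree at least ν on S and at least ν - 1 off S.
These bounds already add up to δ, so they are equalities, and the leading row coefficients, found in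
the bottom rows of H̄, are independent. The m × m minors of H therefore have highest degree δ.
Complementary minors of H and of a generator matrix agree up to a unit
(`exists_unit_det_submatrix_inr_eq`), so the code has degree δ.

A codeword with v_0 ≠ 0 and too light a truncation would be a dependence among columns of H_j^c that
are part of a nonzero minor of H_L^c (`eq_zero_of_slidingMatrix_mulVec_eq_zero`). Conversely, the
first m columns of H are invertible modulo z^(j+1). Column m can thus be cancelled by them modulo
z^(j+1), and X turns the result into a codeword without changing its first j + 1 coefficients
(`exists_truncWeight_le`). -/

theorem mulVec_surjective_of_linearIndependent_row {K ι κ : Type*} [Field K] [Fintype ι]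
    [Fintype κ] {A : Matrix ι κ K} (h : LinearIndependent K A.row) :
    Function.Surjective A.mulVec := by
  have hr : Module.finrank K (LinearMap.range A.mulVecLin) = Module.finrank K (ι → K) := by
    rw [Module.finrank_pi]
    exact h.rank_matrix
  have htop := Submodule.eq_top_of_finrank_eq hr
  exact LinearMap.range_eq_top.1 htop

/-- A matrix with independent rows has a nonzero full-size minor. -/
theorem exists_finset_det_submatrix_ne_zero {K : Type*} [Field K] {m n : ℕ}
    {A : Matrix (Fin m) (Fin n) K} (h : LinearIndependent K A.row) :
    ∃ (s : Finset (Fin n)) (hs : s.card = m),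
      (A.submatrix id (s.orderEmbOfFin hs)).det ≠ 0 := by
  classical
  obtain ⟨κ, a, ha, hspan, hli⟩ := exists_linearIndependent' K A.col
  have : Finite κ := Finite.of_injective a ha
  have := Fintype.ofFinite κ
  have hcard : Fintype.card κ = m := by
    have h1 := finrank_span_eq_card hli
    rw [hspan, ← Matrix.rank_eq_finrank_span_cols, h.rank_matrix, Fintype.card_fin] at h1
    exact h1.symm
  have hs : (Finset.univ.image a).card = m := by
    rw [Finset.card_image_of_injective _ ha, Finset.card_univ, hcard]
  refine ⟨Finset.univ.image a, hs, ?_⟩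
  set t := (Finset.univ.image a).orderEmbOfFin hs
  have hex : ∀ i, ∃ x, a x = t i := fun i => by
    obtain ⟨x, -, hx⟩ := Finset.mem_image.1 (Finset.orderEmbOfFin_mem (Finset.univ.image a) hs i)
    exact ⟨x, hx⟩
  choose f hf using hex
  have hfinj : Function.Injective f := fun i j hij => t.injective (by rw [← hf, ← hf, hij])
  have hcols : LinearIndependent K (A.submatrix id t).col := by
    have hcol : (A.submatrix id t).col = (A.col ∘ a) ∘ f := by
      funext i j
      simp only [Function.comp_apply, Matrix.col_apply, Matrix.submatrix_apply, id, hf]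
    rw [hcol]
    exact hli.comp f hfinj
  exact ((Matrix.isUnit_iff_isUnit_det _).1
    (Matrix.linearIndependent_cols_iff_isUnit.1 hcols)).ne_zero

/-- Complementary minors of a matrix `H` and of a matrix `G` whose rows span its kernel agree up
to a unit. -/
theorem exists_unit_det_submatrix_inr_eq {R ι κ η : Type*} [CommRing R] [Fintype ι] [Fintype κ]
    [Fintype η] [DecidableEq ι] [DecidableEq κ] [DecidableEq η] {H : Matrix ι η R}
    {X : Matrix η ι R} {G Y : Matrix κ η R} (hHX : H * X = 1) (hHG : H * G.transpose = 0)
    (hone : X * H + G.transpose * Y = 1) (e : ι ⊕ κ ≃ η) :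
    ∃ u : R, IsUnit u ∧ (G.submatrix id (e ∘ Sum.inr)).det =
      (H.submatrix id (e ∘ Sum.inl)).det * u := by
  -- `V` is [X Gᵀ] with rows permuted by `e`, an inverse of [H; Y], so its determinant is a unit.
  -- `P` is chosen so that `P * V` is block triangular; determinants then compare the two minors.
  set V : Matrix (ι ⊕ κ) (ι ⊕ κ) R := (Matrix.fromCols X G.transpose).submatrix e id with hV
  set P : Matrix (ι ⊕ κ) (ι ⊕ κ) R :=
    Matrix.fromBlocks (H.submatrix id (e ∘ Sum.inl)) (H.submatrix id (e ∘ Sum.inr)) 0 1 with hP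
  have hVU : V * (Matrix.fromRows H Y).submatrix id e = 1 := by
    rw [hV, ← Matrix.submatrix_mul _ _ e id e Function.bijective_id, Matrix.fromCols_mul_fromRows,
      hone, Matrix.submatrix_one_equiv]
  have hPV : P * V = Matrix.fromBlocks 1 0 (X.submatrix (e ∘ Sum.inr) id)
      (G.submatrix id (e ∘ Sum.inr)).transpose := by
    have key : ∀ (i : ι) (f : η → R), ∑ x, H i (e (Sum.inl x)) * f (e (Sum.inl x)) +
        ∑ x, H i (e (Sum.inr x)) * f (e (Sum.inr x)) = ∑ y, H i y * f y := by
      intro i f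
      rw [← e.sum_comp, Fintype.sum_sum_type]
    have h1 : ∀ i j, ∑ y, H i y * X y j = (1 : Matrix ι ι R) i j := fun i j => by
      rw [← hHX, Matrix.mul_apply]
    have h2 : ∀ i j, ∑ y, H i y * G j y = 0 := fun i j => by
      have := congrFun (congrFun hHG i) j
      simpa [Matrix.mul_apply] using this
    ext (i | i) (j | j)
    · simp [hP, hV, Matrix.mul_apply, key i (fun y => X y j), h1]
    · simp [hP, hV, Matrix.mul_apply, key i (fun y => G j y), h2]
    · simp [hP, hV, Matrix.mul_apply, Matrix.one_apply]
    · simp [hP, hV, Matrix.mul_apply, Matrix.one_apply]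
  refine ⟨V.det, ?_, ?_⟩
  · exact (Matrix.isUnit_iff_isUnit_det _).1 (IsUnit.of_mul_eq_one _ hVU)
  · have := congrArg Matrix.det hPV
    rw [Matrix.det_mul, Matrix.det_fromBlocks_zero₁₂, hP, Matrix.det_fromBlocks_zero₂₁,
      Matrix.det_transpose] at this
    simpa using this.symm

theorem natDegree_prod_le_and_coeff_prod {R ι : Type*} [CommRing R] (s : Finset ι) (f : ι → R[X])
    (d : ι → ℕ) (h : ∀ i ∈ s, (f i).natDegree ≤ d i) :
    (∏ i ∈ s, f i).natDegree ≤ ∑ i ∈ s, d i ∧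
      (∏ i ∈ s, f i).coeff (∑ i ∈ s, d i) = ∏ i ∈ s, (f i).coeff (d i) := by
  classical
  induction s using Finset.induction_on with
  | empty => simp
  | insert a s ha ih =>
    obtain ⟨h1, h2⟩ := ih fun i hi => h i (Finset.mem_insert_of_mem hi)
    have h3 := h a (Finset.mem_insert_self a s)
    rw [Finset.prod_insert ha, Finset.prod_insert ha, Finset.sum_insert ha]
    exact ⟨Polynomial.natDegree_mul_le_of_le h3 h1,
      by rw [Polynomial.coeff_mul_add_eq_of_natDegree_le h3 h1, h2]⟩

/-- Each Leibniz term takes exactly one entry from every row, so row-wise degree bounds add up and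
top coefficients multiply. -/
theorem natDegree_det_le_and_coeff_det {R ι : Type*} [CommRing R] [Fintype ι] [DecidableEq ι]
    (M : Matrix ι ι R[X]) (d : ι → ℕ) (h : ∀ a b, (M a b).natDegree ≤ d a) :
    M.det.natDegree ≤ ∑ a, d a ∧
      M.det.coeff (∑ a, d a) = (Matrix.of fun a b => (M a b).coeff (d a)).det := by
  have hp : ∀ σ : Equiv.Perm ι, (∏ i, M (σ i) i).natDegree ≤ ∑ a, d a ∧
      (∏ i, M (σ i) i).coeff (∑ a, d a) = ∏ i, (M (σ i) i).coeff (d (σ i)) := by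
    intro σ
    rw [← Equiv.sum_comp σ d]
    exact natDegree_prod_le_and_coeff_prod _ _ _ fun i _ => h _ _
  rw [Matrix.det_apply, Matrix.det_apply]
  constructor
  · refine Polynomial.natDegree_sum_le_of_forall_le _ _ fun σ _ => ?_
    exact (Polynomial.natDegree_smul_le _ _).trans (hp σ).1
  · rw [Polynomial.finsetSum_coeff]
    refine Finset.sum_congr rfl fun σ _ => ?_
    rw [Polynomial.coeff_smul, (hp σ).2]
    rfl

end LinearAlgebra

/-! ### The kernel of a right invertible matrix: rank, generators, degree. -/

section Kernel

variable {F : Type*} [Field F] {m n k : ℕ}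

theorem isLeftPrime_of_mul_eq_one {H : Matrix (Fin m) (Fin n) F[X]}
    {X : Matrix (Fin n) (Fin m) F[X]} (hHX : H * X = 1) : IsLeftPrime H := by
  intro M B hMB
  refine IsUnit.of_mul_eq_one (B * X) ?_
  rw [← Matrix.mul_assoc, ← hMB, hHX]

theorem finrank_ker_of_mul_eq_one {H : Matrix (Fin m) (Fin n) F[X]}
    {X : Matrix (Fin n) (Fin m) F[X]} (hHX : H * X = 1) :
    Module.finrank F[X] (LinearMap.ker H.mulVecLin) = n - m := by
  have hsurj : LinearMap.range H.mulVecLin = ⊤ := by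
    refine LinearMap.range_eq_top.2 fun y => ⟨X.mulVec y, ?_⟩
    rw [Matrix.mulVecLin_apply, Matrix.mulVec_mulVec, hHX, Matrix.one_mulVec]
  have := (LinearMap.ker H.mulVecLin).finrank_quotient_add_finrank
  rw [H.mulVecLin.quotKerEquivRange.finrank_eq, hsurj, finrank_top, Module.finrank_fin_fun, Module.finrank_fin_fun] at this
  omega

theorem exists_isGeneratorMatrix_ker {H : Matrix (Fin m) (Fin n) F[X]}
    (hk : Module.finrank F[X] (LinearMap.ker H.mulVecLin) = k) :
    ∃ G : Matrix (Fin k) (Fin n) F[X], IsGeneratorMatrix G (LinearMap.ker H.mulVecLin) := by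
  let b := Module.finBasisOfFinrankEq F[X] (LinearMap.ker H.mulVecLin) hk
  refine ⟨Matrix.of fun i => (b i : Fin n → F[X]), ?_, ?_⟩
  · exact b.linearIndependent.map' (Submodule.subtype _) (Submodule.ker_subtype _)
  · have := congrArg (Submodule.map (LinearMap.ker H.mulVecLin).subtype) b.span_eq
    rw [Submodule.map_span, ← Set.range_comp, Submodule.map_top, Submodule.range_subtype] at this
    exact this

/-- The highest degree of the full-size minors of a generator matrix of the kernel of a right
invertible matrix `H` is that of `H`, namely the sum of the row degrees if the leading row
coefficients are independent. -/
theorem maxMinorDegree_generator_ker {H : Matrix (Fin m) (Fin n) F[X]}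
    {X : Matrix (Fin n) (Fin m) F[X]} (hHX : H * X = 1) {d : Fin m → ℕ}
    (hd : ∀ a b, (H a b).natDegree ≤ d a)
    (hlead : LinearIndependent F (Matrix.of fun a b => (H a b).coeff (d a)).row)
    (hmk : m + k = n)
    {G : Matrix (Fin k) (Fin n) F[X]} (hG : IsGeneratorMatrix G (LinearMap.ker H.mulVecLin)) :
    maxMinorDegree G = ∑ a, d a := by
  classical
  have hGmem : ∀ i, H.mulVec (G i) = 0 := fun i => by
    have : G.row i ∈ LinearMap.ker H.mulVecLin := by
      rw [← hG.2]; exact Submodule.subset_span ⟨i, rfl⟩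
    exact this
  have hHG : H * G.transpose = 0 := by
    ext1 a i
    exact congrFun (hGmem i) a
  -- H (1 - X H) = 0, so the columns of 1 - X H are combinations of the rows of `G`; the
  -- coefficients form the matrix Y with X H + Gᵀ Y = 1.
  have hY : ∀ j : Fin n, ∃ y : Fin k → F[X],
      ∑ i, y i • G.row i = (1 - X * H : Matrix (Fin n) (Fin n) F[X]).col j := by
    intro j
    have hmem : (1 - X * H : Matrix (Fin n) (Fin n) F[X]).col j ∈
        LinearMap.ker H.mulVecLin := by
      rw [LinearMap.mem_ker, Matrix.mulVecLin_apply]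
      have h0 : H * (1 - X * H) = 0 := by
        rw [Matrix.mul_sub, ← Matrix.mul_assoc, hHX, Matrix.mul_one, Matrix.one_mul, sub_self]
      ext1 a
      exact congrFun (congrFun h0 a) j
    rw [← hG.2] at hmem
    exact (Submodule.mem_span_range_iff_exists_fun _).1 hmem
  choose y hy using hY
  have hone : X * H + G.transpose * (Matrix.of fun i j => y j i) = 1 := by
    rw [eq_comm, ← sub_eq_iff_eq_add']
    ext1 i j
    have := congrFun (hy j) i
    simp only [Finset.sum_apply, Pi.smul_apply, smul_eq_mul, Matrix.col_apply,
      Matrix.row_apply] at this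
    rw [← this, Matrix.mul_apply]
    exact Finset.sum_congr rfl fun l _ => mul_comm _ _
  have hminor : ∀ (s : Finset (Fin n)) (hs : s.card = m) (hs' : sᶜ.card = k),
      (G.submatrix id (sᶜ.orderEmbOfFin hs')).det.natDegree =
        (H.submatrix id (s.orderEmbOfFin hs)).det.natDegree := by
    intro s hs hs'
    obtain ⟨u, hu, h⟩ := exists_unit_det_submatrix_inr_eq hHX hHG hone (finSumEquivOfFinset hs hs')
    have e1 : (finSumEquivOfFinset hs hs') ∘ Sum.inl = s.orderEmbOfFin hs := by
      funext i; simp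
    have e2 : (finSumEquivOfFinset hs hs') ∘ Sum.inr = sᶜ.orderEmbOfFin hs' := by
      funext i; simp
    rw [e1, e2] at h
    rw [h]
    by_cases h0 : (H.submatrix id (s.orderEmbOfFin hs)).det = 0
    · simp [h0]
    · rw [Polynomial.natDegree_mul h0 hu.ne_zero, Polynomial.natDegree_eq_zero_of_isUnit hu,
        add_zero]
  apply le_antisymm
  · refine Finset.sup_le fun t _ => ?_
    set s : Finset (Fin n) := (Finset.univ.map t.toEmbedding)ᶜ with hsdef
    have hsc : sᶜ = Finset.univ.map t.toEmbedding := by rw [hsdef, compl_compl]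
    have hs' : sᶜ.card = k := by rw [hsc]; simp
    have hs : s.card = m := by
      have := s.card_add_card_compl
      rw [hs', Fintype.card_fin] at this
      omega
    have ht : sᶜ.orderEmbOfFin hs' = t := by
      refine (Finset.orderEmbOfFin_unique' hs' fun i => ?_).symm
      rw [hsc]; simp
    have := hminor s hs hs'
    rw [ht] at this
    rw [this]
    exact (natDegree_det_le_and_coeff_det _ d fun a b => hd _ _).1
  -- A nonzero minor of the leading coefficient matrix is the coefficient of degree `∑ a, d a` in
  -- the corresponding minor of `H`.
  · obtain ⟨s, hs, hdet⟩ := exists_finset_det_submatrix_ne_zero hlead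
    have hs' : sᶜ.card = k := by
      have := s.card_add_card_compl
      rw [hs, Fintype.card_fin] at this
      omega
    have hle : ∑ a, d a ≤ (H.submatrix id (s.orderEmbOfFin hs)).det.natDegree := by
      refine Polynomial.le_natDegree_of_ne_zero ?_
      rw [(natDegree_det_le_and_coeff_det (H.submatrix id (s.orderEmbOfFin hs)) d
        fun a b => hd _ _).2]
      exact hdet
    rw [← hminor s hs hs'] at hle
    exact hle.trans (Finset.le_sup (f := fun t : Fin k ↪o Fin n =>
      (G.submatrix id t).det.natDegree) (Finset.mem_univ _))

end Kernel

/-! ### Consequences of the full row rank of H̄: row degrees and a right inverse. -/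

section BarMatrix

variable {F : Type*} [Field F] {m n : ℕ}

theorem natDegree_le_rowDegree (H : Matrix (Fin m) (Fin n) F[X]) (a : Fin m) (b : Fin n) :
    (H a b).natDegree ≤ rowDegree H a :=
  Finset.le_sup (f := fun b => (H a b).natDegree) (Finset.mem_univ b)

theorem exists_coeff_ne_zero_of_row_inr_ne_zero {H : Matrix (Fin m) (Fin n) F[X]} {ν r : ℕ}
    {S : Finset (Fin m)} {a : S} (h : (barMatrix H ν r S).row (Sum.inr a) ≠ 0) :
    ∃ b, (H a b).coeff ν ≠ 0 := by
  by_contra! h0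
  refine h (funext fun q => ?_)
  simp [barMatrix, Matrix.row, h0]

/-- In the last complete block row, of index r + ν - 1, the block columns l ≤ r contain only
coefficients of index r + ν - 1 - l ≥ ν - 1. -/
theorem exists_coeff_ne_zero_of_row_inl_ne_zero {H : Matrix (Fin m) (Fin n) F[X]} {ν r : ℕ}
    {S : Finset (Fin m)} {i : Fin (r + ν)} {a : Fin m} (hi : (i : ℕ) + 1 = r + ν)
    (h : (barMatrix H ν r S).row (Sum.inl (i, a)) ≠ 0) :
    ∃ (b : Fin n) (l : ℕ), ν - 1 ≤ l ∧ (H a b).coeff l ≠ 0 := by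
  by_contra! h0
  refine h (funext fun q => ?_)
  have hq := q.1.isLt
  have : (H a q.2).coeff ((i : ℕ) - (q.1 : ℕ)) = 0 := h0 _ _ (by omega)
  simp [barMatrix, Matrix.row, this]

/-- If `H̄` has independent rows, then the row degrees of `H` are the generic ones: `ν` for the rows
in `S` and `ν - 1` for the others. -/
theorem rowDegree_eq_of_linearIndependent_barMatrix {H : Matrix (Fin m) (Fin n) F[X]} {ν r : ℕ}
    {S : Finset (Fin m)} (hν : 1 ≤ ν)
    (hsum : ∑ a, rowDegree H a = m * (ν - 1) + S.card)
    (hbar : LinearIndependent F (barMatrix H ν r S).row) (a : Fin m) :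
    rowDegree H a = (ν - 1) + if a ∈ S then 1 else 0 := by
  have hle : ∀ a ∈ Finset.univ, (ν - 1) + (if a ∈ S then 1 else 0) ≤ rowDegree H a := by
    intro a _
    by_cases ha : a ∈ S
    · obtain ⟨b, hb⟩ := exists_coeff_ne_zero_of_row_inr_ne_zero (hbar.ne_zero (Sum.inr ⟨a, ha⟩))
      have := (Polynomial.le_natDegree_of_ne_zero hb).trans (natDegree_le_rowDegree H a b)
      rw [if_pos ha]
      omega
    · obtain ⟨b, l, hl, hb⟩ := exists_coeff_ne_zero_of_row_inl_ne_zero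
        (i := ⟨r + ν - 1, by omega⟩) (by simp only; omega) (hbar.ne_zero (Sum.inl (_, a)))
      have := (Polynomial.le_natDegree_of_ne_zero hb).trans (natDegree_le_rowDegree H a b)
      rw [if_neg ha]
      omega
  -- Termwise bounds whose sums agree are equalities.
  refine ((Finset.sum_eq_sum_iff_of_le hle).1 ?_ a (Finset.mem_univ a)).symm
  rw [hsum, Finset.sum_add_distrib]
  simp

/-- Padded by zeros to the left, the leading coefficients of a row in `S` form a row of the last
block row of H̄. Those of a row outside `S` form a row of the last complete block row, whose earlier
blocks vanish by degree. -/
theorem linearIndependent_leadingCoeff_of_barMatrix {H : Matrix (Fin m) (Fin n) F[X]} {ν r : ℕ}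
    {S : Finset (Fin m)} (hν : 1 ≤ ν)
    (hrow : ∀ a, rowDegree H a = (ν - 1) + if a ∈ S then 1 else 0)
    (hbar : LinearIndependent F (barMatrix H ν r S).row) :
    LinearIndependent F (Matrix.of fun a b => (H a b).coeff (rowDegree H a)).row := by
  classical
  let f : Fin m → (Fin (r + ν) × Fin m) ⊕ S := fun a =>
    if h : a ∈ S then Sum.inr ⟨a, h⟩ else Sum.inl (⟨r + ν - 1, by omega⟩, a)
  have hf : Function.Injective f := by
    intro a a' h
    by_cases ha : a ∈ S <;> by_cases ha' : a' ∈ S <;> simp_all [f]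
  let φ : (Fin n → F) →ₗ[F] (Fin (r + 1) × Fin n → F) :=
    LinearMap.pi fun q => if (q.1 : ℕ) = r then LinearMap.proj q.2 else 0
  have hφ : ∀ x q, φ x q = if (q.1 : ℕ) = r then x q.2 else 0 := by
    intro x q
    simp only [φ, LinearMap.pi_apply]
    split_ifs <;> simp
  refine LinearIndependent.of_comp φ ?_
  convert hbar.comp f hf using 1
  funext a q
  have hq := q.1.isLt
  rw [Function.comp_apply, hφ, Function.comp_apply, Matrix.row_apply, Matrix.row_apply,
    Matrix.of_apply]
  by_cases ha : a ∈ S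
  · have h1 : ν - 1 + 1 = ν := by omega
    have hfa : f a = Sum.inr ⟨a, ha⟩ := dif_pos ha
    rw [hfa, hrow a, if_pos ha, h1]
    rfl
  · have hfa : f a = Sum.inl (⟨r + ν - 1, by omega⟩, a) := dif_neg ha
    by_cases hqr : (q.1 : ℕ) = r
    · have h1 : r ≤ r + ν - 1 := by omega
      have h2 : r + ν - 1 - r = ν - 1 := by omega
      simp [hfa, ha, barMatrix, hrow a, hqr, h1, h2]
    · have h0 : (H a q.2).coeff (r + ν - 1 - q.1) = 0 := by
        refine Polynomial.coeff_eq_zero_of_natDegree_lt ?_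
        have := natDegree_le_rowDegree H a q.2
        rw [hrow a, if_neg ha] at this
        omega
      simp [hfa, barMatrix, hqr, h0]

theorem coeff_mul_sum_monomial (p : F[X]) (r i : ℕ) (x : Fin (r + 1) → F) :
    (p * ∑ l : Fin (r + 1), Polynomial.monomial (l : ℕ) (x l)).coeff i =
      ∑ l : Fin (r + 1), (if (l : ℕ) ≤ i then p.coeff (i - l) else 0) * x l := by
  rw [Finset.mul_sum, Polynomial.finsetSum_coeff]
  refine Finset.sum_congr rfl fun l _ => ?_
  rw [← Polynomial.C_mul_X_pow_eq_monomial, ← mul_assoc, Polynomial.coeff_mul_X_pow',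
    Polynomial.coeff_mul_C, ite_mul, zero_mul]

/-- If `H̄` has independent rows and the rows of `H` outside of `S` have degree less than `ν`, then
`H` has a polynomial right inverse. -/
theorem exists_mul_eq_one_of_linearIndependent_barMatrix {H : Matrix (Fin m) (Fin n) F[X]}
    {ν r : ℕ} {S : Finset (Fin m)} (hν : 1 ≤ ν)
    (hdeg : ∀ a b, (H a b).natDegree ≤ ν) (hS : ∀ a ∉ S, ∀ b, (H a b).natDegree < ν)
    (hbar : LinearIndependent F (barMatrix H ν r S).row) :
    ∃ X : Matrix (Fin n) (Fin m) F[X], H * X = 1 := by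
  classical
  have hsurj := mulVec_surjective_of_linearIndependent_row hbar
  -- The right-hand side lists the coefficients of the constant unit vector at `a₀`; the solution
  -- lists those of column `a₀` of the right inverse.
  choose x hx using fun a₀ : Fin m => hsurj
    (Sum.elim (fun p => if (p.1 : ℕ) = 0 ∧ p.2 = a₀ then 1 else 0) 0)
  refine ⟨Matrix.of fun b a₀ => ∑ l : Fin (r + 1), Polynomial.monomial (l : ℕ) (x a₀ (l, b)), ?_⟩
  ext a a₀ i
  have hcoeff : ((H * Matrix.of fun b a₀ => ∑ l : Fin (r + 1),
      Polynomial.monomial (l : ℕ) (x a₀ (l, b))) a a₀).coeff i =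
      ∑ q : Fin (r + 1) × Fin n,
        (if (q.1 : ℕ) ≤ i then (H a q.2).coeff (i - q.1) else 0) * x a₀ q := by
    rw [Matrix.mul_apply, Polynomial.finsetSum_coeff, Fintype.sum_prod_type_right]
    exact Finset.sum_congr rfl fun b _ => coeff_mul_sum_monomial _ _ _ _
  have hone : ((1 : Matrix (Fin m) (Fin m) F[X]) a a₀).coeff i =
      if i = 0 ∧ a = a₀ then 1 else 0 := by
    rw [Matrix.one_apply]
    by_cases h : a = a₀ <;> simp [h, Polynomial.coeff_one]
  rw [hcoeff, hone]
  -- Degrees below r + ν are governed by the complete block rows. In degree r + ν only rows in `S`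
  -- can contribute, through the last block row; above it everything vanishes.
  rcases lt_trichotomy i (r + ν) with hi | hi | hi
  · have := congrFun (hx a₀) (Sum.inl (⟨i, hi⟩, a))
    simpa [Matrix.mulVec, dotProduct, barMatrix] using this
  · rw [if_neg (by omega)]
    by_cases ha : a ∈ S
    · have := congrFun (hx a₀) (Sum.inr ⟨a, ha⟩)
      refine Eq.trans (Finset.sum_congr rfl fun q _ => ?_) this
      have hq := q.1.isLt
      congr 1
      by_cases hqr : (q.1 : ℕ) = r
      · simp [barMatrix, hqr, hi]
      · have h0 : (H a q.2).coeff (i - q.1) = 0 :=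
          Polynomial.coeff_eq_zero_of_natDegree_lt ((hdeg _ _).trans_lt (by omega))
        simp [barMatrix, hqr, h0]
    · refine Finset.sum_eq_zero fun q _ => ?_
      have hq := q.1.isLt
      rw [Polynomial.coeff_eq_zero_of_natDegree_lt ((hS a ha q.2).trans_le (by omega)), ite_self,
        zero_mul]
  · rw [if_neg (by omega)]
    refine Finset.sum_eq_zero fun q _ => ?_
    have hq := q.1.isLt
    rw [Polynomial.coeff_eq_zero_of_natDegree_lt ((hdeg a q.2).trans_lt (by omega)), ite_self,
      zero_mul]

end BarMatrix

/-! ### Counting columns of the sliding matrix by blocks. -/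

section ColumnCounting

/-- An increasing enumeration lists the members of an initial segment first. This translates
positions t_{sm} ≤ sn into numbers of columns in the first s blocks. -/
theorem orderEmbOfFin_apply_iff_lt_card_filter {α : Type*} [LinearOrder α] {T : Finset α} {c : ℕ}
    (h : T.card = c) {P : α → Prop} [DecidablePred P] (hP : ∀ x y, x ≤ y → P y → P x)
    (i : Fin c) : P (T.orderEmbOfFin h i) ↔ (i : ℕ) < (T.filter P).card := by
  constructor
  · intro hi
    have hsub : (Finset.Iic i).map (T.orderEmbOfFin h).toEmbedding ⊆ T.filter P := by
      intro x hx
      obtain ⟨l, hl, rfl⟩ := Finset.mem_map.1 hx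
      exact Finset.mem_filter.2 ⟨Finset.orderEmbOfFin_mem _ _ _,
        hP _ _ ((T.orderEmbOfFin h).monotone (Finset.mem_Iic.1 hl)) hi⟩
    have := Finset.card_le_card hsub
    rw [Finset.card_map, Fin.card_Iic] at this
    omega
  · intro hi
    by_contra hn
    have hsub : T.filter P ⊆ (Finset.Iio i).map (T.orderEmbOfFin h).toEmbedding := by
      intro x hx
      obtain ⟨hxT, hxP⟩ := Finset.mem_filter.1 hx
      have : x ∈ Set.range (T.orderEmbOfFin h) := by
        rw [Finset.range_orderEmbOfFin]; exact hxT
      obtain ⟨l, rfl⟩ := this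
      refine Finset.mem_map.2 ⟨l, Finset.mem_Iio.2 ?_, rfl⟩
      by_contra hl
      exact hn (hP _ _ ((T.orderEmbOfFin h).monotone (not_lt.1 hl)) hxP)
    have := Finset.card_le_card hsub
    rw [Finset.card_map, Fin.card_Iio] at this
    omega

theorem divNat_finProdFinEquiv {N n : ℕ} (x : Fin N × Fin n) : (finProdFinEquiv x).divNat = x.1 :=
  congrArg Prod.fst (finProdFinEquiv.symm_apply_apply x)

theorem modNat_finProdFinEquiv {N n : ℕ} (x : Fin N × Fin n) : (finProdFinEquiv x).modNat = x.2 :=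
  congrArg Prod.snd (finProdFinEquiv.symm_apply_apply x)

/-- Counting columns block by block. -/
theorem card_filter_divNat_modNat {N n : ℕ} (a s : ℕ) (hs : s ≤ N) (P : ℕ → Fin n → Prop)
    [∀ i b, Decidable (P i b)] :
    (Finset.univ.filter fun q : Fin (N * n) =>
      a ≤ (q.divNat : ℕ) ∧ (q.divNat : ℕ) < s ∧ P q.divNat q.modNat).card =
      ∑ i ∈ Finset.Ico a s, (Finset.univ.filter fun b => P i b).card := by
  have h1 : (Finset.univ.filter fun q : Fin (N * n) =>
      a ≤ (q.divNat : ℕ) ∧ (q.divNat : ℕ) < s ∧ P q.divNat q.modNat).card =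
      ((Finset.Ico a s).sigma fun i => Finset.univ.filter fun b => P i b).card := by
    refine Finset.card_bij (fun q _ => ⟨(q.divNat : ℕ), q.modNat⟩) ?_ ?_ ?_
    · intro q hq
      simp only [Finset.mem_filter, Finset.mem_univ, true_and] at hq
      simp only [Finset.mem_sigma, Finset.mem_Ico, Finset.mem_filter, Finset.mem_univ, true_and]
      exact ⟨⟨hq.1, hq.2.1⟩, hq.2.2⟩
    · intro q _ q' _ h
      simp only [Sigma.mk.injEq, heq_eq_eq] at h
      exact finProdFinEquiv.symm.injective (Prod.ext (Fin.ext h.1) h.2)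
    · rintro ⟨i, b⟩ hib
      simp only [Finset.mem_sigma, Finset.mem_Ico, Finset.mem_filter, Finset.mem_univ,
        true_and] at hib
      refine ⟨finProdFinEquiv (⟨i, by omega⟩, b), ?_, ?_⟩
      · simp only [Finset.mem_filter, Finset.mem_univ, true_and, divNat_finProdFinEquiv,
          modNat_finProdFinEquiv]
        exact ⟨hib.1.1, hib.1.2, hib.2⟩
      · simp only [divNat_finProdFinEquiv, modNat_finProdFinEquiv]
  rw [h1, Finset.card_sigma]

theorem divNat_lt_iff {N n s : ℕ} (q : Fin (N * n)) : (q.divNat : ℕ) < s ↔ (q : ℕ) < s * n := by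
  have hn : 0 < n := Nat.pos_of_ne_zero fun h => by subst h; exact absurd q.isLt (by simp)
  exact Nat.div_lt_iff_lt_mul hn

/-- Columns in the first `j + 1` blocks that satisfy the counting condition of a not trivially zero
minor up to block `j` extend to the columns of a not trivially zero full-size minor, without
using further columns of the first `j + 1` blocks than needed. -/
theorem exists_superset_columns {m n L j : ℕ} (hmn : m ≤ n) (hj : j ≤ L)
    {W : Finset (Fin ((L + 1) * n))} (hW : ∀ q ∈ W, (q.divNat : ℕ) < j + 1)
    (hcard : W.card ≤ (j + 1) * m)
    (hcount : ∀ s, 1 ≤ s → s ≤ j → s * m ≤ (W.filter fun q => (q.divNat : ℕ) < s).card) :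
    ∃ T, W ⊆ T ∧ T.card = (L + 1) * m ∧
      (T.filter fun q => (q.divNat : ℕ) < j + 1).card = (j + 1) * m ∧
      ∀ s, 1 ≤ s → s ≤ L → s * m ≤ (T.filter fun q => (q.divNat : ℕ) < s).card := by
  have hblock : (Finset.univ.filter fun q : Fin ((L + 1) * n) =>
      0 ≤ (q.divNat : ℕ) ∧ (q.divNat : ℕ) < j + 1 ∧ True).card = (j + 1) * n := by
    rw [card_filter_divNat_modNat 0 (j + 1) (by omega) fun _ _ => True]
    simp
  obtain ⟨W₁, hWW₁, hW₁, hW₁card⟩ := Finset.exists_subsuperset_card_eq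
    (s := W) (t := Finset.univ.filter fun q : Fin ((L + 1) * n) =>
      0 ≤ (q.divNat : ℕ) ∧ (q.divNat : ℕ) < j + 1 ∧ True)
    (fun q hq => by simpa using hW q hq) hcard
    (hblock ▸ Nat.mul_le_mul_left _ hmn)
  replace hW₁ : ∀ q ∈ W₁, (q.divNat : ℕ) < j + 1 := fun q hq => by simpa using hW₁ hq
  -- After block `j`, the first `m` columns of every block are added, which keeps the count at
  -- exactly s * m.
  let E : ℕ → Finset (Fin ((L + 1) * n)) := fun s => Finset.univ.filter fun q =>
    j + 1 ≤ (q.divNat : ℕ) ∧ (q.divNat : ℕ) < s ∧ (q.modNat : ℕ) < m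
  have hE : ∀ s ≤ L + 1, (E s).card = (s - (j + 1)) * m := by
    intro s hs
    have := card_filter_divNat_modNat (N := L + 1) (n := n) (j + 1) s hs fun _ b => (b : ℕ) < m
    rw [this]
    simp [Fin.card_filter_val_lt, hmn]
  have hmemE : ∀ s q, q ∈ E s ↔
      j + 1 ≤ (q.divNat : ℕ) ∧ (q.divNat : ℕ) < s ∧ (q.modNat : ℕ) < m := by
    intro s q
    simp [E]
  have hdisj : ∀ s, Disjoint W₁ (E s) := fun s => Finset.disjoint_left.2 fun q hq hq' => by
    have h1 := hW₁ q hq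
    have h2 := ((hmemE s q).1 hq').1
    omega
  have hfilter : ∀ s, j + 1 ≤ s → s ≤ L + 1 →
      ((W₁ ∪ E (L + 1)).filter fun q => (q.divNat : ℕ) < s).card = s * m := by
    intro s hs hs'
    have : ((W₁ ∪ E (L + 1)).filter fun q => (q.divNat : ℕ) < s) = W₁ ∪ E s := by
      ext q
      simp only [Finset.mem_filter, Finset.mem_union, hmemE]
      have := hW₁ q
      constructor
      · rintro ⟨h | h, h'⟩
        · exact Or.inl h
        · exact Or.inr ⟨h.1, h', h.2.2⟩
      · rintro (h | h)
        · exact ⟨Or.inl h, (this h).trans_le hs⟩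
        · exact ⟨Or.inr ⟨h.1, by omega, h.2.2⟩, h.2.1⟩
    rw [this, Finset.card_union_of_disjoint (hdisj s), hW₁card, hE s hs', ← Nat.add_mul]
    congr 1
    omega
  refine ⟨W₁ ∪ E (L + 1), hWW₁.trans Finset.subset_union_left, ?_, hfilter _ le_rfl (by omega), ?_⟩
  · rw [Finset.card_union_of_disjoint (hdisj _), hW₁card, hE _ le_rfl, ← Nat.add_mul]
    congr 1
    omega
  · intro s hs hsL
    rcases le_or_gt (j + 1) s with h | h
    · exact (hfilter s h (by omega)).ge
    · exact (hcount s hs (by omega)).trans (Finset.card_le_card (Finset.filter_subset_filter _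
        (hWW₁.trans Finset.subset_union_left)))

end ColumnCounting

/-! ### Column distances: lower and upper bounds. -/

section ColumnDistance

variable {F : Type*} [Field F] {m n : ℕ}

/-- The minor criterion as an independence statement for the columns of `H_j^c`, `j ≤ L`. -/
theorem eq_zero_of_slidingMatrix_mulVec_eq_zero {H : Matrix (Fin m) (Fin n) F[X]} {L j : ℕ}
    (hmin : MDPMinorCriterion H L) (hmn : m ≤ n) (hj : j ≤ L)
    {W : Finset (Fin ((L + 1) * n))} (hW : ∀ q ∈ W, (q.divNat : ℕ) < j + 1)
    (hcard : W.card ≤ (j + 1) * m)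
    (hcount : ∀ s, 1 ≤ s → s ≤ j → s * m ≤ (W.filter fun q => (q.divNat : ℕ) < s).card)
    {u : Fin ((L + 1) * n) → F} (hu : ∀ q ∉ W, u q = 0)
    (h0 : ∀ p : Fin ((L + 1) * m), (p.divNat : ℕ) < j + 1 → (slidingMatrix H L).mulVec u p = 0) :
    u = 0 := by
  classical
  obtain ⟨T, hWT, hT, hTj, hTs⟩ := exists_superset_columns hmn hj hW hcard hcount
  set t := T.orderEmbOfFin hT with ht
  have hdown : ∀ s, ∀ x y : Fin ((L + 1) * n), x ≤ y → (y.divNat : ℕ) < s →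
      (x.divNat : ℕ) < s := by
    intro s x y hxy hy
    rw [divNat_lt_iff] at hy ⊢
    exact lt_of_le_of_lt hxy hy
  have hlt : ∀ (s : ℕ) (i : Fin ((L + 1) * m)), ((t i).divNat : ℕ) < s ↔
      (i : ℕ) < (T.filter fun q => (q.divNat : ℕ) < s).card := fun s i =>
    orderEmbOfFin_apply_iff_lt_card_filter hT (P := fun q => (q.divNat : ℕ) < s) (hdown s) i
  have hdet := hmin t fun s i hs hsL hi => by
    rw [← divNat_lt_iff, hlt]
    have := hTs s hs hsL
    omega
  -- Exactly (j + 1) * m columns of `T` lie in the first j + 1 blocks, so `p` marks these columns as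
  -- well as the first j + 1 block rows. Hence `A` is block triangular with square diagonal blocks,
  -- and its leading block is invertible.
  let p : Fin ((L + 1) * m) → Prop := fun i => (i.divNat : ℕ) < j + 1
  have htp : ∀ i, ((t i).divNat : ℕ) < j + 1 ↔ p i := fun i => by
    rw [hlt, hTj]
    exact (divNat_lt_iff i).symm
  set A := (slidingMatrix H L).submatrix id t with hA
  have hzero : ∀ i, p i → ∀ i', ¬ p i' → A i i' = 0 := by
    intro i hi i' hi'
    rw [← htp] at hi'
    have : ¬ (t i').divNat ≤ i.divNat := fun h => hi' (lt_of_le_of_lt h hi)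
    simp [hA, slidingMatrix, this]
  rw [Matrix.twoBlockTriangular_det' A p hzero] at hdet
  have hx : (fun i : {i // p i} => u (t i)) = 0 := by
    refine Matrix.eq_zero_of_mulVec_eq_zero (left_ne_zero_of_mul hdet) ?_
    funext i
    rw [Pi.zero_apply, ← h0 i i.2]
    have e1 : (slidingMatrix H L).mulVec u i = ∑ i', A i i' * u (t i') := by
      have : Finset.univ.map t.toEmbedding = T := by
        rw [ht]
        exact Finset.map_orderEmbOfFin_univ T hT
      rw [Matrix.mulVec, dotProduct]
      rw [← Finset.sum_subset T.subset_univ, ← this, Finset.sum_map]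
      · rfl
      · intro q _ hq
        rw [hu q fun h => hq (hWT h), mul_zero]
    rw [e1, ← Finset.sum_subset (Finset.subset_univ (Finset.univ.filter p)), Finset.sum_subtype
      (p := p) _ (fun i => by simp)]
    · rfl
    · intro i' _ hi'
      rw [hzero i i.2 i' (by simpa using hi'), zero_mul]
  funext q
  by_cases hq : q ∈ W
  · have : q ∈ Set.range t := by
      rw [ht, Finset.range_orderEmbOfFin]
      exact hWT hq
    obtain ⟨i, rfl⟩ := this
    exact congrFun hx ⟨i, (htp i).1 (hW _ hq)⟩
  · exact hu q hq

/-- Multiplying `H_L^c` with the coefficients of `v` gives the coefficients of `H v`. -/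
theorem slidingMatrix_mulVec_eq_coeff (H : Matrix (Fin m) (Fin n) F[X]) (L : ℕ)
    (v : Fin n → F[X]) {u : Fin ((L + 1) * n) → F} (p : Fin ((L + 1) * m))
    (hu : ∀ q, q.divNat ≤ p.divNat → u q = (v q.modNat).coeff q.divNat) :
    (slidingMatrix H L).mulVec u p = (H.mulVec v p.modNat).coeff p.divNat := by
  have e1 : (slidingMatrix H L).mulVec u p = ∑ q : Fin ((L + 1) * n),
      (if q.divNat ≤ p.divNat then (H p.modNat q.modNat).coeff ((p.divNat : ℕ) - (q.divNat : ℕ)) *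
        (v q.modNat).coeff q.divNat else 0) := by
    rw [Matrix.mulVec, dotProduct]
    refine Finset.sum_congr rfl fun q _ => ?_
    rw [slidingMatrix, Matrix.of_apply]
    split_ifs with h
    · rw [hu q h]
    · rw [zero_mul]
  rw [e1, ← (finProdFinEquiv (m := L + 1) (n := n)).sum_comp, Fintype.sum_prod_type_right]
  rw [Matrix.mulVec, dotProduct, Polynomial.finsetSum_coeff]
  refine Finset.sum_congr rfl fun b _ => ?_
  simp only [divNat_finProdFinEquiv, modNat_finProdFinEquiv]
  rw [mul_comm (H p.modNat b), Polynomial.coeff_mul,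
    Finset.Nat.sum_antidiagonal_eq_sum_range_succ_mk]
  have e2 := Fin.sum_univ_eq_sum_range (fun l => if l ≤ (p.divNat : ℕ) then
    (H p.modNat b).coeff ((p.divNat : ℕ) - l) * (v b).coeff l else 0) (L + 1)
  simp only [Fin.le_def]
  rw [e2, ← Finset.sum_filter]
  have hp := p.divNat.isLt
  have e3 : (Finset.range (L + 1)).filter (fun l => l ≤ (p.divNat : ℕ)) =
      Finset.range ((p.divNat : ℕ) + 1) := by
    ext l
    simp only [Finset.mem_filter, Finset.mem_range]
    omega
  rw [e3]
  exact Finset.sum_congr rfl fun l _ => mul_comm _ _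

theorem truncWeight_eq_card {L : ℕ} (v : Fin n → F[X]) {j : ℕ} (hj : j ≤ L)
    [DecidablePred fun q : Fin ((L + 1) * n) =>
      (q.divNat : ℕ) < j + 1 ∧ (v q.modNat).coeff q.divNat ≠ 0] :
    truncWeight v j = (Finset.univ.filter fun q : Fin ((L + 1) * n) =>
      (q.divNat : ℕ) < j + 1 ∧ (v q.modNat).coeff q.divNat ≠ 0).card := by
  classical
  have := card_filter_divNat_modNat (N := L + 1) 0 (j + 1) (by omega)
    fun i b => (v b).coeff i ≠ 0
  rw [truncWeight, Finset.range_eq_Ico]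
  have hset : (Finset.univ.filter fun q : Fin ((L + 1) * n) =>
      (q.divNat : ℕ) < j + 1 ∧ (v q.modNat).coeff q.divNat ≠ 0) = Finset.univ.filter fun q =>
      0 ≤ (q.divNat : ℕ) ∧ (q.divNat : ℕ) < j + 1 ∧ (v q.modNat).coeff q.divNat ≠ 0 := by
    ext q
    simp only [Finset.mem_filter, Nat.zero_le, true_and]
  rw [hset]
  exact Eq.trans rfl (this.symm.trans (by congr))

/-- The lower bound for the column distances. -/
theorem le_truncWeight_of_minorCriterion {H : Matrix (Fin m) (Fin n) F[X]} {L : ℕ}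
    (hmin : MDPMinorCriterion H L) (hmn : m ≤ n) {v : Fin n → F[X]} (hv : H.mulVec v = 0)
    (hv0 : (fun b => (v b).coeff 0) ≠ 0) (j : ℕ) (hj : j ≤ L) :
    m * (j + 1) + 1 ≤ truncWeight v j := by
  classical
  -- The bounds for smaller indices put more than s * m nonzero coefficients into the first s
  -- blocks. This is the counting condition needed for the support of the truncation.
  induction j using Nat.strong_induction_on with
  | _ j ih =>
  by_contra hlt
  set W := Finset.univ.filter fun q : Fin ((L + 1) * n) =>
    (q.divNat : ℕ) < j + 1 ∧ (v q.modNat).coeff q.divNat ≠ 0 with hWdef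
  have hcard : W.card ≤ (j + 1) * m := by
    rw [← truncWeight_eq_card v hj, mul_comm]
    omega
  have hcount : ∀ s, 1 ≤ s → s ≤ j →
      s * m ≤ (W.filter fun q => (q.divNat : ℕ) < s).card := by
    intro s hs hsj
    have h1 := ih (s - 1) (by omega) (by omega)
    rw [truncWeight_eq_card (L := L) v (by omega), Nat.sub_add_cancel hs] at h1
    have : (W.filter fun q => (q.divNat : ℕ) < s) = Finset.univ.filter fun q =>
        (q.divNat : ℕ) < s ∧ (v q.modNat).coeff q.divNat ≠ 0 := by
      ext q
      simp only [hWdef, Finset.mem_filter, Finset.mem_univ, true_and]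
      constructor
      · rintro ⟨⟨_, h⟩, h'⟩; exact ⟨h', h⟩
      · rintro ⟨h, h'⟩; exact ⟨⟨by omega, h'⟩, h⟩
    rw [this, mul_comm]
    omega
  set u : Fin ((L + 1) * n) → F := fun q =>
    if (q.divNat : ℕ) < j + 1 then (v q.modNat).coeff q.divNat else 0 with hudef
  have hu := eq_zero_of_slidingMatrix_mulVec_eq_zero hmin hmn hj (W := W) (u := u)
    (fun q hq => (Finset.mem_filter.1 hq).2.1) hcard hcount
    (fun q hq => by
      simp only [hudef]
      split_ifs with h
      · by_contra h'
        exact hq (Finset.mem_filter.2 ⟨Finset.mem_univ _, h, h'⟩)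
      · rfl)
    (fun p hp => by
      rw [slidingMatrix_mulVec_eq_coeff H L v p fun q hq =>
        if_pos (lt_of_le_of_lt (Fin.le_def.1 hq) hp), hv]
      simp)
  refine hv0 (funext fun b => ?_)
  have := congrFun hu (finProdFinEquiv (0, b))
  simp only [hudef, divNat_finProdFinEquiv, modNat_finProdFinEquiv] at this
  simpa using this

/-- Under the minor criterion the first `m` columns of `H_0` are independent. -/
theorem det_coeff_zero_ne_zero_of_minorCriterion {H : Matrix (Fin m) (Fin n) F[X]} {L : ℕ}
    (hmin : MDPMinorCriterion H L) (hmn : m ≤ n) :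
    (H.submatrix id (Fin.castLE hmn)).det.coeff 0 ≠ 0 := by
  classical
  intro hdet
  have h1 : (H.submatrix id (Fin.castLE hmn)).det.coeff 0 =
      ((H.submatrix id (Fin.castLE hmn)).map (Polynomial.constantCoeff)).det := by
    rw [← Polynomial.constantCoeff_apply, RingHom.map_det, RingHom.mapMatrix_apply]
  rw [h1] at hdet
  obtain ⟨x, hx0, hx⟩ := Matrix.exists_mulVec_eq_zero_iff.2 hdet
  let v : Fin n → F[X] := fun b => if h : (b : ℕ) < m then Polynomial.C (x ⟨b, h⟩) else 0
  have hHv : ∀ a, (H.mulVec v a).coeff 0 = 0 := by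
    intro a
    rw [← show _ = (0 : F) from congrFun hx a, Matrix.mulVec, dotProduct,
      Polynomial.finsetSum_coeff, Matrix.mulVec, dotProduct]
    symm
    refine Finset.sum_of_injOn (Fin.castLE hmn) (Fin.castLE_injective hmn).injOn
      (fun _ _ => by simp) ?_ ?_
    · intro b _ hb
      have : ¬ (b : ℕ) < m := fun h => hb ⟨⟨b, h⟩, by simp, rfl⟩
      simp [v, this]
    · intro i _
      simp [v]
  set W := Finset.univ.filter fun q : Fin ((L + 1) * n) =>
    0 ≤ (q.divNat : ℕ) ∧ (q.divNat : ℕ) < 0 + 1 ∧ (q.modNat : ℕ) < m with hWdef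
  have hWcard : W.card = m := by
    rw [hWdef, card_filter_divNat_modNat (N := L + 1) (n := n) 0 (0 + 1) (by omega)
      fun _ b => (b : ℕ) < m]
    simp [Fin.card_filter_val_lt, hmn]
  -- For j = 0 the counting condition is vacuous.
  have hu := eq_zero_of_slidingMatrix_mulVec_eq_zero hmin hmn (Nat.zero_le L) (W := W)
    (u := fun q => if (q.divNat : ℕ) < 0 + 1 then (v q.modNat).coeff q.divNat else 0)
    (fun q hq => (Finset.mem_filter.1 hq).2.2.1) (by omega) (fun s hs hs' => by omega)
    (fun q hq => by
      split_ifs with h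
      · have : ¬ (q.modNat : ℕ) < m := fun h' =>
          hq (Finset.mem_filter.2 ⟨Finset.mem_univ _, Nat.zero_le _, h, h'⟩)
        simp only [v, dif_neg this, Polynomial.coeff_zero]
      · rfl)
    (fun p hp => by
      rw [slidingMatrix_mulVec_eq_coeff H L v p fun q hq =>
        if_pos (lt_of_le_of_lt (Fin.le_def.1 hq) hp)]
      have : (p.divNat : ℕ) = 0 := by omega
      rw [this, hHv])
  refine hx0 (funext fun i => ?_)
  have := congrFun hu (finProdFinEquiv (0, Fin.castLE hmn i))
  simp only [divNat_finProdFinEquiv, modNat_finProdFinEquiv] at this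
  simpa [v] using this

/-- A right invertible `H` whose first `m` columns are independent at `0` has codewords attaining
the Singleton-type bound for the column distances. -/
theorem exists_truncWeight_le {H : Matrix (Fin m) (Fin n) F[X]} {X : Matrix (Fin n) (Fin m) F[X]}
    (hHX : H * X = 1) (hmn : m < n)
    (hdet : (H.submatrix id (Fin.castLE hmn.le)).det.coeff 0 ≠ 0) (j : ℕ) :
    ∃ v, H.mulVec v = 0 ∧ (fun b => (v b).coeff 0) ≠ 0 ∧ truncWeight v j ≤ m * (j + 1) + 1 := by
  classical
  set M := H.submatrix id (Fin.castLE hmn.le) with hM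
  -- The Bézout coefficient `α` below inverts `M.det` modulo X^(j+1).
  have hcop : IsCoprime M.det (Polynomial.X ^ (j + 1) : F[X]) := by
    refine IsCoprime.pow_right (IsCoprime.symm ?_)
    rw [(Polynomial.irreducible_X (R := F)).coprime_iff_not_dvd, Polynomial.X_dvd_iff]
    exact hdet
  obtain ⟨α, β, hαβ⟩ := hcop
  let c : Fin n := ⟨m, hmn⟩
  let h : Fin m → F[X] := fun a => H a c
  -- Cramer's rule: M x ≡ -h modulo X^(j+1), so `x` cancels column `c`.
  let x : Fin m → F[X] := -(α • M.adjugate.mulVec h)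
  let w : Fin n → F[X] := fun b => if hb : (b : ℕ) < m then x ⟨b, hb⟩ else if b = c then 1 else 0
  have hHw : H.mulVec w = (Polynomial.X ^ (j + 1) : F[X]) • (β • h) := by
    have e1 : H.mulVec w = M.mulVec x + h := by
      funext a
      have e2 : ∑ b, H a b * (if hb : (b : ℕ) < m then x ⟨b, hb⟩ else 0) = M.mulVec x a := by
        rw [Matrix.mulVec, dotProduct]
        symm
        refine Finset.sum_of_injOn (Fin.castLE hmn.le) (Fin.castLE_injective hmn.le).injOn
          (fun _ _ => by simp) ?_ ?_
        · intro b _ hb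
          have : ¬ (b : ℕ) < m := fun h => hb ⟨⟨b, h⟩, by simp, rfl⟩
          simp [this]
        · intro i _
          simp [hM]
      have e3 : ∀ b, w b = (if hb : (b : ℕ) < m then x ⟨b, hb⟩ else 0) +
          if b = c then 1 else 0 := by
        intro b
        by_cases hb : (b : ℕ) < m
        · have : b ≠ c := fun h => by rw [h] at hb; exact lt_irrefl _ hb
          simp [w, hb, this]
        · simp [w, hb]
      rw [Matrix.mulVec, dotProduct]
      simp only [e3, mul_add, Finset.sum_add_distrib, e2]
      simp [h]
    have e4 : M.mulVec x = -((α * M.det) • h) := by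
      simp only [x, Matrix.mulVec_neg, Matrix.mulVec_smul, Matrix.mulVec_mulVec,
        Matrix.mul_adjugate, Matrix.smul_mulVec, Matrix.one_mulVec, smul_smul]
    have e5 : α * M.det = 1 - β * Polynomial.X ^ (j + 1) := by rw [← hαβ]; ring
    rw [e1, e4, e5, sub_smul, one_smul, smul_smul, mul_comm β]
    abel
  -- H w = X^(j+1) β h, and the right inverse lifts β h, so subtracting this multiple of X^(j+1)
  -- gives a codeword.
  let v : Fin n → F[X] := w - (Polynomial.X ^ (j + 1) : F[X]) • X.mulVec (β • h)
  have hvw : ∀ b, ∀ i < j + 1, (v b).coeff i = (w b).coeff i := by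
    intro b i hi
    simp [v, Polynomial.coeff_X_pow_mul', not_le.2 hi]
  refine ⟨v, ?_, ?_, ?_⟩
  · rw [Matrix.mulVec_sub, Matrix.mulVec_smul, Matrix.mulVec_mulVec, hHX, Matrix.one_mulVec, hHw,
      sub_self]
  · intro h0
    have := congrFun h0 c
    simp only [hvw c 0 (Nat.succ_pos j)] at this
    simp [w, c] at this
  -- Position `c` carries the constant 1, so it counts only for i = 0; every other nonzero entry is
  -- in one of the first `m` positions.
  · have hbound : ∀ i ∈ Finset.range (j + 1),
        hammingNorm (fun b => (v b).coeff i) ≤ m + if i = 0 then 1 else 0 := by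
      intro i hi
      have hsub : (Finset.univ.filter fun b => (v b).coeff i ≠ 0) ⊆
          (Finset.univ.filter fun b : Fin n => (b : ℕ) < m) ∪ if i = 0 then {c} else ∅ := by
        intro b hb
        have hb' := (Finset.mem_filter.1 hb).2
        rw [hvw b i (Finset.mem_range.1 hi)] at hb'
        rw [Finset.mem_union]
        by_cases hbm : (b : ℕ) < m
        · exact Or.inl (by simpa using hbm)
        · right
          by_cases hbc : b = c
          · by_cases hi0 : i = 0
            · simp [hi0, hbc]
            · simp [w, hbc, c, Polynomial.coeff_one, hi0] at hb'
          · simp [w, hbm, hbc] at hb'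
      refine (Finset.card_le_card hsub).trans ((Finset.card_union_le _ _).trans ?_)
      refine add_le_add ?_ ?_
      · simp [Fin.card_filter_val_lt]
      · split_ifs <;> simp
    refine (Finset.sum_le_sum hbound).trans ?_
    rw [Finset.sum_add_distrib]
    simp [mul_comm]

theorem columnDistance_ker_eq {H : Matrix (Fin m) (Fin n) F[X]} {X : Matrix (Fin n) (Fin m) F[X]}
    (hHX : H * X = 1) (hmn : m < n) {L : ℕ} (hmin : MDPMinorCriterion H L) {j : ℕ} (hj : j ≤ L) :
    columnDistance (LinearMap.ker H.mulVecLin) j = m * (j + 1) + 1 := by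
  have hlow := fun v (hv : H.mulVec v = 0) hv0 =>
    le_truncWeight_of_minorCriterion hmin hmn.le (v := v) hv hv0 j hj
  obtain ⟨v, hv, hv0, hw⟩ := exists_truncWeight_le hHX hmn
    (det_coeff_zero_ne_zero_of_minorCriterion hmin hmn.le) j
  -- The attaining codeword also excludes the default value 0 of `sInf` on the empty set.
  refine IsLeast.csInf_eq ⟨⟨v, hv, hv0, le_antisymm hw (hlow v hv hv0)⟩, ?_⟩
  rintro _ ⟨v', hv', hv0', rfl⟩
  exact hlow v' hv' hv0'

end ColumnDistance

end ConvCode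

theorem mainTheorem5 {F : Type*} [Field F] [Finite F] (n k δ ν : ℕ)
    (hk : 0 < k) (hkn : k < n) (hδ : ¬ (n - k) ∣ δ) (hν : ν = δ / (n - k) + 1)
    (H : Matrix (Fin (n - k)) (Fin n) (Polynomial F))
    (hdeg : ∀ a b, (H a b).natDegree ≤ ν)
    (hred : ConvCode.IsRowReduced H)
    (hsum : ∑ a, ConvCode.rowDegree H a = δ)
    (hminors : ConvCode.MDPMinorCriterion H (δ / k + ν - 1))
    (hbar : ∃ (r : ℕ) (S : Finset (Fin (n - k))), S.card = δ - (n - k) * (δ / (n - k)) ∧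
      LinearIndependent F (ConvCode.barMatrix H ν r S).row) :
    ConvCode.IsLeftPrime H ∧
      ∃ C : Submodule (Polynomial F) (Fin n → Polynomial F),
        ConvCode.IsMDP n k δ C ∧ ConvCode.IsParityCheckMatrix H C := by
  obtain ⟨r, S, hS, hbar⟩ := hbar
  have hν1 : 1 ≤ ν := hν ▸ Nat.le_add_left 1 _
  have hrow := ConvCode.rowDegree_eq_of_linearIndependent_barMatrix hν1 (by
    -- Division with remainder: δ = (n - k)(ν - 1) + |S|.
    have := Nat.mul_div_le δ (n - k)
    rw [hsum, hS, hν, Nat.add_sub_cancel]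
    omega) hbar
  have hlead := ConvCode.linearIndependent_leadingCoeff_of_barMatrix hν1 hrow hbar
  obtain ⟨X, hHX⟩ := ConvCode.exists_mul_eq_one_of_linearIndependent_barMatrix hν1 hdeg
    (fun a ha b => by
      have := ConvCode.natDegree_le_rowDegree H a b
      rw [hrow a, if_neg ha] at this
      omega) hbar
  have hfin : Module.finrank (Polynomial F) (LinearMap.ker H.mulVecLin) = k := by
    rw [ConvCode.finrank_ker_of_mul_eq_one hHX]
    omega
  obtain ⟨G, hG⟩ := ConvCode.exists_isGeneratorMatrix_ker hfin
  refine ⟨ConvCode.isLeftPrime_of_mul_eq_one hHX, LinearMap.ker H.mulVecLin,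
    ⟨⟨hfin, G, hG, ?_⟩, fun j hj => ?_⟩, fun c => Iff.rfl⟩
  · rw [ConvCode.maxMinorDegree_generator_ker hHX (ConvCode.natDegree_le_rowDegree H) hlead
      (by omega) hG, hsum]
  · exact ConvCode.columnDistance_ker_eq hHX (by omega) hminors (by omega)
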